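/- Let $\Phi:\mathbb R^3\to\mathbb R$ be the potential of an integrable system, with energy $E(x,v)=\tfrac12\langle v,v\rangle+\Phi(x)$. That is, a region $M\subseteq\mathbb R^3_x\times\mathbb R^3_v$ of phase space (the part occupied by the system) is a union of invariant 3-tori $\{J=\mathrm{const}\}$ given by $C^1$ action-angle variables $(\theta,J)$: $J$ ranges over an open subset of $\mathbb R^3$, $\theta\in(\mathbb R/2\pi\mathbb Z)^3$, the map $(\theta,J)\mapsto(x,v)$ is injective and canonical, $\Phi$ is differentiable at all positions reached, and $E=E(J)$ (several such systems of variables may be needed to cover $M$). Call a function $f$ a steady-state distribution function on an open set $\Omega$ in the potential $\Phi$ if $f$ is $C^1$ on $\Omega$ and $\langle v,\nabla_x f\rangle-\langle\nabla\Phi,\nabla_v f\rangle=0$ on $\Omega$. Theorem. Let $f_1,f_2,f_3:\mathbb R^3\times\mathbb R^3\to\mathbb R$ be steady-state distribution functions in the potential $\Phi$ on a common open set $\Omega\subseteq M$, and let them be independent, i.e. their differentials are linearly independent at every point of $\Omega$. (1) If almost all tori of the system (with respect to $J$) are non-resonant, i.e. the frequencies $\partial E/\partial J_i$ are linearly independent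 over $\mathbb Q$, then for every invariant torus $\mathcal T$ of the system with $\mathcal T\subseteq\Omega$ and every $p\in\mathcal T$, the connected component containing $p$ of the intersection of level sets $\{q\in\Omega: f_i(q)=f_i(p),\ i=1,2,3\}$ is exactly $\mathcal T$. So there the intersections of the level sets are invariant tori, and their parts are pieces of invariant tori. (2) Let $(\Gamma_k)$ be a family of torus patches in $\Omega$ formed by parts of the surfaces $f_i=\mathrm{const}$: each $\Gamma_k\subseteq\Omega$ is a nonempty, connected, relatively open part of an invariant torus of the system, and each $f_i$ is constant on it. Suppose the family is connected in $x$: any two patches are joined by a finite succession of patches of the family in which consecutive ones contain points with a common position $x$. Let $\Psi:\mathbb R^3\to\mathbb R$ be any potential (integrable or not), differentiable at all positions occurring in $\Omega$, in which $f_1,f_2,f_3$ are also steady-state distribution functions on $\Omega$. Then: (a) there are constants $e_k$ with $\Psi(x)=e_k-\tfrac12\langle v,v\rangle$ for all $(x,v)\in\Gamma_k$, and $e_l=e_k+\tfrac12(\langle v',v'\rangle-\langle v,v\rangle)$ whenever $(x,v)\in\Gamma_k$ and $(x,v')\in\Gamma_l$; (b) there is a constant $c$ with $\Psi(x)=\Phi(x)+c$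 at every position $x$ covered by the patches. Thus the $f_i$ determine the potential uniquely, up to an additive constant, on the set of positions covered by the chain. -/

import Mathlib

open Set MeasureTheory

noncomputable section

namespace DynTomography

/-- Euclidean three-space; also used for the actions and for the (lifted) angles. -/
abbrev Space : Type := EuclideanSpace ℝ (Fin 3)

/-- Phase space: pairs `(x, v)` of position and velocity. -/
abbrev Phase : Type := Space × Space

/-- The energy `E(x,v) = ⟨v,v⟩/2 + Φ(x)`. -/
def energy (Φ : Space → ℝ) (p : Phase) : ℝ := (1 / 2) * ‖p.2‖ ^ 2 + Φ p.1

/-- `f` is a steady-state distribution function on the open set `Ω` in the potential `Φ`: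
it is continuously differentiable and solves the time-independent collisionless Boltzmann
equation `⟨v, ∇ₓ f⟩ - ⟨∇Φ, ∇ᵥ f⟩ = 0` on `Ω`. -/
def IsSteadyState (Φ : Space → ℝ) (Ω : Set Phase) (f : Phase → ℝ) : Prop :=
  ContDiffOn ℝ 1 f Ω ∧
    ∀ p ∈ Ω, fderiv ℝ f p (p.2, 0) - fderiv ℝ f p (0, gradient Φ p.1) = 0

/-- Functional independence of three functions on `Ω`: their differentials are linearly
independent at every point. -/
def IndependentOn (Ω : Set Phase) (f : Fin 3 → Phase → ℝ) : Prop :=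
  ∀ p ∈ Ω, LinearIndependent ℝ (fun i => fderiv ℝ (f i) p)

/-- The canonical symplectic form `∑ dqᵢ ∧ dpᵢ` on pairs `(q, p)`. -/
def sympl (a b : Space × Space) : ℝ := inner ℝ a.1 b.2 - inner ℝ a.2 b.1

/-- The vector `2πk` for an integer vector `k`. -/
def period (k : Fin 3 → ℤ) : Space := WithLp.toLp 2 (fun i => 2 * Real.pi * (k i : ℝ))

/-- Action-angle variables `(θ, J)` for the Hamiltonian `E = ⟨v,v⟩/2 + Φ(x)` on a part of phase
space.  The angle `θ` is lifted from the torus `(ℝ/2πℤ)³` to `ℝ³`. -/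
structure ActionAngle (Φ : Space → ℝ) where
  /-- the range of the actions `J` -/
  actions : Set Space
  isOpen_actions : IsOpen actions
  /-- the phase point `(x, v)` with angle-action coordinates `(θ, J)` -/
  toPhase : Space × Space → Phase
  contDiffOn : ContDiffOn ℝ 1 toPhase (univ ×ˢ actions)
  periodic : ∀ θ, ∀ J ∈ actions, ∀ k, toPhase (θ + period k, J) = toPhase (θ, J)
  injective : ∀ θ θ', ∀ J ∈ actions, ∀ J' ∈ actions, toPhase (θ, J) = toPhase (θ', J') →
    J = J' ∧ ∃ k, θ' = θ + period k
  /-- the transformation is canonical, with `θ` as positions and `J` as momenta -/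
  canonical : ∀ θ, ∀ J ∈ actions, ∀ a b,
    sympl (fderiv ℝ toPhase (θ, J) a) (fderiv ℝ toPhase (θ, J) b) = sympl a b
  /-- the potential is differentiable at every position reached by the tori -/
  differentiable : ∀ θ, ∀ J ∈ actions, DifferentiableAt ℝ Φ (toPhase (θ, J)).1
  /-- the energy as a function of the actions -/
  hamiltonian : Space → ℝ
  energy_eq : ∀ θ, ∀ J ∈ actions, energy Φ (toPhase (θ, J)) = hamiltonian J

/-- The invariant 3-torus with actions `J`. -/
def ActionAngle.torus {Φ : Space → ℝ} (A : ActionAngle Φ) (J : Space) : Set Phase :=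
  range (fun θ => A.toPhase (θ, J))

/-- The frequency vector `∂E/∂J` of the torus with actions `J` has no integer relation. -/
def ActionAngle.NonresonantAt {Φ : Space → ℝ} (A : ActionAngle Φ) (J : Space) : Prop :=
  ∀ k : Fin 3 → ℤ, ∑ i, (k i : ℝ) * gradient A.hamiltonian J i = 0 → k = 0

/-- An integrable system with potential `Φ`: the part of phase space that it occupies is covered
by systems of action-angle variables. -/
structure IntegrableSystem (Φ : Space → ℝ) where
  /-- the part of phase space filled by the 3-tori of the system -/
  region : Set Phase
  /-- the action-angle variables that describe the system -/
  charts : Set (ActionAngle Φ)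
  torus_subset : ∀ A ∈ charts, ∀ J ∈ A.actions, A.torus J ⊆ region
  exists_torus : ∀ p ∈ region, ∃ A ∈ charts, ∃ J ∈ A.actions, p ∈ A.torus J

/-- `T` is one of the invariant 3-tori of the integrable system. -/
def IntegrableSystem.IsTorus {Φ : Space → ℝ} (S : IntegrableSystem Φ) (T : Set Phase) : Prop :=
  ∃ A ∈ S.charts, ∃ J ∈ A.actions, T = A.torus J

/-- Almost all tori of the system are non-resonant. -/
def IntegrableSystem.Nonresonant {Φ : Space → ℝ} (S : IntegrableSystem Φ) : Prop :=
  ∀ A ∈ S.charts, ∀ᵐ J ∂(volume.restrict A.actions), A.NonresonantAt J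

/-- The part inside `Ω` of the intersection of the level surfaces of the `fᵢ` through `p`. -/
def commonLevel (Ω : Set Phase) (f : Fin 3 → Phase → ℝ) (p : Phase) : Set Phase :=
  {q ∈ Ω | ∀ i, f i q = f i p}

/-- `Γ ⊆ Ω` is a torus patch cut out by level surfaces of the `fᵢ`: a (nonempty) connected,
relatively open part of an invariant torus of the system on which every `fᵢ` is constant. -/
def IsTorusPatch {Φ : Space → ℝ} (S : IntegrableSystem Φ) (Ω : Set Phase)
    (f : Fin 3 → Phase → ℝ) (Γ : Set Phase) : Prop :=
  IsConnected Γ ∧ Γ ⊆ Ω ∧ (∃ T, S.IsTorus T ∧ ∃ U, IsOpen U ∧ Γ = T ∩ U) ∧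
    ∃ c : Fin 3 → ℝ, ∀ p ∈ Γ, ∀ i, f i p = c i

/-- A family of patches is connected in `x`: any two are joined by a finite succession of patches
of the family in which consecutive ones have a common position `x`. -/
def ConnectedInX {ι : Type*} (Γ : ι → Set Phase) : Prop :=
  ∀ k l, Relation.ReflTransGen
    (fun a b => ((Prod.fst '' Γ a) ∩ (Prod.fst '' Γ b)).Nonempty) k l

end DynTomography

end

/-! A steady state is a function annihilated by the Hamiltonian field `(v, -∇Φ)`, which in
action-angle variables is the constant field `(∂E/∂J, 0)` on each torus.

For (1), Fourier coefficients show that a continuous function invariant under a non-resonant linear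
flow is constant; density of non-resonant actions extends this to every torus in `Ω`
(`IsSteadyState.eq_on_torus`). The `f i` then depend locally on `J` alone, and independence makes
them coordinates in `J`. So a torus is open in the level set (`eventually_mem_torus_of_eq`), and it
is also compact and connected.

For (2), the common kernel of the `df i` on a patch is exactly the tangent space of the torus, which
is Lagrangian. The field `(v, -∇Ψ)` lies in that kernel, so the differential of the `Ψ`-energy, its
symplectic dual, vanishes along the patch (`IsTorusPatch.energy_eq`). The same holds for `Φ`, so `Ψ
- Φ` is constant on each patch, and common positions carry the constant along the chain. -/

/-! ### Fourier analysis of linear flows on the torus. -/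

theorem UnitAddTorus.mFourier_apply_add {d : Type*} [Fintype d] (n : d → ℤ)
    (x y : UnitAddTorus d) :
    UnitAddTorus.mFourier n (x + y) = UnitAddTorus.mFourier n x * UnitAddTorus.mFourier n y := by
  simp only [UnitAddTorus.mFourier, ContinuousMap.coe_mk, Pi.add_apply, fourier_apply, smul_add,
    AddCircle.toCircle_add, Circle.coe_mul, Finset.prod_mul_distrib]

theorem UnitAddTorus.mFourier_apply_coe {d : Type*} [Fintype d] (n : d → ℤ) (x : d → ℝ) :
    UnitAddTorus.mFourier n (fun i => (x i : UnitAddCircle))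
      = Complex.exp (2 * Real.pi * Complex.I * (∑ i, (n i : ℝ) * x i : ℝ)) := by
  simp only [UnitAddTorus.mFourier, ContinuousMap.coe_mk, fourier_coe_apply, ← Complex.exp_sum]
  congr 1
  push_cast
  rw [Finset.mul_sum]
  refine Finset.sum_congr rfl fun i _ => ?_
  ring

/-- A continuous function on the torus invariant under a linear flow whose frequencies have no
integer relation is constant. -/
theorem UnitAddTorus.eq_of_flow_invariant {d : Type*} [Fintype d] (G : C(UnitAddTorus d, ℂ))
    (w : d → ℝ) (hw : ∀ k : d → ℤ, ∑ i, (k i : ℝ) * w i = 0 → k = 0)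
    (hG : ∀ (t : ℝ) x, G (x + fun i => ((t * w i : ℝ) : UnitAddCircle)) = G x)
    (x y : UnitAddTorus d) : G x = G y := by
  have hc : ∀ n : d → ℤ, n ≠ 0 → UnitAddTorus.mFourierCoeff G n = 0 := by
    intro n hn
    have hσ : ∑ i : d, (((-n) i : ℤ) : ℝ) * w i ≠ 0 := fun h => hn (neg_eq_zero.1 (hw (-n) h))
    set σ := ∑ i : d, (((-n) i : ℤ) : ℝ) * w i with hσd
    -- The flow time `1 / (2σ)` makes the character `-n` change sign, so the coefficient equals its
    -- own negative.
    set s : UnitAddTorus d := fun i => ((1 / (2 * σ) * w i : ℝ) : UnitAddCircle) with hs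
    have hexp : UnitAddTorus.mFourier (-n) s = -1 := by
      rw [hs, UnitAddTorus.mFourier_apply_coe]
      have : ∑ i : d, (((-n) i : ℤ) : ℝ) * (1 / (2 * σ) * w i) = 1 / 2 := by
        simp_rw [mul_left_comm _ (1 / (2 * σ)), ← Finset.mul_sum]
        rw [← hσd]
        field_simp
      rw [this, ← Complex.exp_pi_mul_I]
      congr 1
      push_cast
      ring
    let μ : Measure (UnitAddTorus d) := Measure.pi fun _ => AddCircle.haarAddCircle
    have hdef : UnitAddTorus.mFourierCoeff G n
        = ∫ t, UnitAddTorus.mFourier (-n) t • G t ∂μ := rfl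
    have h1 : ∫ t, UnitAddTorus.mFourier (-n) t • G t ∂μ
        = ∫ t, UnitAddTorus.mFourier (-n) (t + s) • G (t + s) ∂μ :=
      (integral_add_right_eq_self (fun t => UnitAddTorus.mFourier (-n) t • G t) s).symm
    have h2 : ∀ t, UnitAddTorus.mFourier (-n) (t + s) • G (t + s)
        = -(UnitAddTorus.mFourier (-n) t • G t) := by
      intro t
      rw [UnitAddTorus.mFourier_apply_add, hexp, hG]
      simp
    simp only [h2, integral_neg] at h1
    rw [hdef]
    exact self_eq_neg.1 h1
  have hsum : Summable (UnitAddTorus.mFourierCoeff G) :=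
    summable_of_ne_finset_zero (s := {0}) fun n hn => hc n (by simpa using hn)
  have key : ∀ z, G z = UnitAddTorus.mFourierCoeff G 0 := by
    intro z
    have h := UnitAddTorus.hasSum_mFourier_series_apply_of_summable hsum z
    have h' := hasSum_single (f := fun n => UnitAddTorus.mFourierCoeff G n •
      UnitAddTorus.mFourier n z) 0 (fun n hn => by simp [hc n hn])
    simpa [UnitAddTorus.mFourier_zero] using h.unique h'
  rw [key x, key y]

namespace DynTomography

open Filter Topology

/-- A continuous function of the (lifted) angles which is invariant under a linear flow without
resonances is constant. -/
theorem eq_of_periodic_of_flow_invariant {g : Space → ℝ} (hg : Continuous g)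
    (hper : ∀ θ k, g (θ + period k) = g θ) {w : Space}
    (hw : ∀ k : Fin 3 → ℤ, ∑ i, (k i : ℝ) * w i = 0 → k = 0)
    (hflow : ∀ θ (t : ℝ), g (θ + t • w) = g θ) (θ θ' : Space) : g θ = g θ' := by
  let q : (Fin 3 → ℝ) → UnitAddTorus (Fin 3) := Pi.map fun _ x => (x : UnitAddCircle)
  have hq : IsOpenQuotientMap q :=
    IsOpenQuotientMap.piMap fun _ => QuotientAddGroup.isOpenQuotientMap_mk
  -- The factor `2π` passes to circles of length 1; time `t` there is time `2πt` for the angles.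
  let g₀ : C(Fin 3 → ℝ, ℂ) :=
    ⟨fun x => (g (WithLp.toLp 2 fun i => 2 * Real.pi * x i) : ℂ), by fun_prop⟩
  have hfac : Function.FactorsThrough g₀ q := by
    intro x y hxy
    have : ∀ i, ∃ k : ℤ, y i = x i + k := by
      intro i
      have h := congrFun hxy i
      simp only [q, Pi.map_apply] at h
      rw [eq_comm, QuotientAddGroup.eq, AddSubgroup.mem_zmultiples_iff] at h
      obtain ⟨k, hk⟩ := h
      refine ⟨-k, ?_⟩
      simp only [zsmul_eq_mul, mul_one] at hk
      push_cast
      linarith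
    choose k hk using this
    have : (WithLp.toLp 2 fun i => 2 * Real.pi * y i : Space)
        = (WithLp.toLp 2 fun i => 2 * Real.pi * x i) + period k := by
      ext i
      simp [period, hk i, mul_add]
    simp only [g₀, ContinuousMap.coe_mk, this, hper]
  let Q : C(Fin 3 → ℝ, UnitAddTorus (Fin 3)) := ⟨q, hq.continuous⟩
  have hQ : Topology.IsQuotientMap Q := hq.isQuotientMap
  let G : C(UnitAddTorus (Fin 3), ℂ) := hQ.lift g₀ hfac
  have hGq : ∀ x, G (q x) = g₀ x := fun x => DFunLike.congr_fun (hQ.lift_comp g₀ hfac) x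
  have hinv : ∀ (t : ℝ) x, G (x + fun i => ((t * w i : ℝ) : UnitAddCircle)) = G x := by
    intro t x
    obtain ⟨x, rfl⟩ := hq.surjective x
    have : (q x + fun i => ((t * w i : ℝ) : UnitAddCircle)) = q (fun i => x i + t * w i) := by
      ext i
      simp [q]
    rw [this, hGq, hGq]
    simp only [g₀, ContinuousMap.coe_mk]
    rw [← hflow (WithLp.toLp 2 fun i => 2 * Real.pi * x i) (2 * Real.pi * t)]
    congr 2
    ext i
    simp [mul_add, mul_assoc]
  have h := UnitAddTorus.eq_of_flow_invariant G w hw hinv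
    (q fun i => θ i / (2 * Real.pi)) (q fun i => θ' i / (2 * Real.pi))
  rw [hGq, hGq] at h
  simp only [g₀, ContinuousMap.coe_mk, Complex.ofReal_inj] at h
  have hθ : ∀ η : Space, (WithLp.toLp 2 fun i => 2 * Real.pi * (η i / (2 * Real.pi))) = η := by
    intro η
    ext i
    simp only
    field_simp
  rwa [hθ, hθ] at h

/-! ### The symplectic form and Hamiltonian fields. -/

theorem sympl_sub_left (a b c : Space × Space) : sympl (a - b) c = sympl a c - sympl b c := by
  simp only [sympl, Prod.fst_sub, Prod.snd_sub, inner_sub_left]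
  ring

theorem eq_zero_of_sympl_eq_zero {a : Space × Space} (h : ∀ b, sympl a b = 0) : a = 0 := by
  have h1 := h (0, a.1)
  have h2 := h (a.2, 0)
  simp only [sympl, inner_zero_right, sub_zero, zero_sub, neg_eq_zero, inner_self_eq_zero]
    at h1 h2
  exact Prod.ext h1 h2

/-- Hamilton's equations in the form `dE = ω(X, ·)`, later applied to both `Φ` and `Ψ`. -/
theorem exists_hasFDerivAt_energy {Ψ : Space → ℝ} {p : Phase} (h : DifferentiableAt ℝ Ψ p.1) :
    ∃ e : Phase →L[ℝ] ℝ, HasFDerivAt (energy Ψ) e p ∧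
      ∀ w, e w = sympl (p.2, -gradient Ψ p.1) w := by
  have h1 : HasFDerivAt (fun q : Phase => Ψ q.1)
      ((InnerProductSpace.toDual ℝ Space (gradient Ψ p.1)).comp
        (ContinuousLinearMap.fst ℝ Space Space)) p :=
    h.hasGradientAt.hasFDerivAt.comp p hasFDerivAt_fst
  have h2 : HasFDerivAt (fun q : Phase => ‖q.2‖ ^ 2) _ p :=
    (hasStrictFDerivAt_norm_sq p.2).hasFDerivAt.comp p hasFDerivAt_snd
  refine ⟨_, (h2.const_mul (1 / 2)).add h1, fun w => ?_⟩
  simp [sympl]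

theorem IsSteadyState.fderiv_apply_eq_zero {Ψ : Space → ℝ} {Ω : Set Phase} {f : Phase → ℝ}
    (hf : IsSteadyState Ψ Ω f) {p : Phase} (hp : p ∈ Ω) :
    fderiv ℝ f p (p.2, -gradient Ψ p.1) = 0 := by
  rw [← hf.2 p hp, ← map_sub]
  simp

theorem IsSteadyState.hasStrictFDerivAt {Ψ : Space → ℝ} {Ω : Set Phase} {f : Phase → ℝ}
    (hf : IsSteadyState Ψ Ω f) (hΩ : IsOpen Ω) {p : Phase} (hp : p ∈ Ω) :
    HasStrictFDerivAt f (fderiv ℝ f p) p :=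
  (hf.1.contDiffAt (hΩ.mem_nhds hp)).hasStrictFDerivAt one_ne_zero

/-! ### Local geometry of action-angle variables. -/

namespace ActionAngle

variable {Φ : Space → ℝ} (A : ActionAngle Φ) {J : Space}

theorem hasStrictFDerivAt (hJ : J ∈ A.actions) (θ : Space) :
    HasStrictFDerivAt A.toPhase (fderiv ℝ A.toPhase (θ, J)) (θ, J) :=
  (A.contDiffOn.contDiffAt ((isOpen_univ.prod A.isOpen_actions).mem_nhds
    ⟨mem_univ _, hJ⟩)).hasStrictFDerivAt one_ne_zero

/-- A map preserving a nondegenerate form has no kernel. Equal dimensions then make it a local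
diffeomorphism. -/
theorem fderiv_injective (hJ : J ∈ A.actions) (θ : Space) :
    Function.Injective (fderiv ℝ A.toPhase (θ, J)) := by
  refine (injective_iff_map_eq_zero _).2 fun a ha => eq_zero_of_sympl_eq_zero fun b => ?_
  rw [← A.canonical θ J hJ a b, ha]
  simp [sympl]

theorem fderiv_surjective (hJ : J ∈ A.actions) (θ : Space) :
    Function.Surjective (fderiv ℝ A.toPhase (θ, J)) :=
  LinearMap.injective_iff_surjective (f := (fderiv ℝ A.toPhase (θ, J)).toLinearMap).1
    (A.fderiv_injective hJ θ)

theorem map_nhds_toPhase (hJ : J ∈ A.actions) (θ : Space) :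
    map A.toPhase (𝓝 (θ, J)) = 𝓝 (A.toPhase (θ, J)) :=
  (A.hasStrictFDerivAt hJ θ).map_nhds_eq_of_surj
    (LinearMap.range_eq_top.2 (A.fderiv_surjective hJ θ))

theorem continuous_toPhase_left (hJ : J ∈ A.actions) : Continuous fun η => A.toPhase (η, J) :=
  continuous_iff_continuousAt.2 fun η =>
    (A.hasStrictFDerivAt hJ η).continuousAt.comp (f := fun η => (η, J))
      (by fun_prop)

/-- A property of the angles near `θ` holds at all points of the torus near `(θ, J)`. -/
theorem eventually_mem_torus (hJ : J ∈ A.actions) (θ : Space) {P : Phase → Prop}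
    (h : ∀ᶠ η in 𝓝 θ, P (A.toPhase (η, J))) :
    ∀ᶠ q in 𝓝 (A.toPhase (θ, J)), q ∈ A.torus J → P q := by
  rw [← A.map_nhds_toPhase hJ θ, eventually_map]
  have h1 : ∀ᶠ z : Space × Space in 𝓝 (θ, J), P (A.toPhase (z.1, J)) :=
    (continuousAt_fst (p := (θ, J))).eventually
      (p := fun η => P (A.toPhase (η, J))) h
  have h2 : ∀ᶠ z : Space × Space in 𝓝 (θ, J), z.2 ∈ A.actions :=
    continuousAt_snd.eventually (A.isOpen_actions.mem_nhds hJ)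
  filter_upwards [h1, h2] with z hz hz2
  rintro ⟨η, hη⟩
  -- Injectivity forces the action of a nearby torus point to be `J`, so the torus cannot return
  -- near the point on another sheet.
  obtain ⟨h, -⟩ := A.injective _ _ _ hJ _ hz2 hη
  rwa [h] at hz

/-- Differentiability is inherited from the energy along the section `θ = 0`. -/
theorem hasGradientAt_hamiltonian (hJ : J ∈ A.actions) :
    HasGradientAt A.hamiltonian (gradient A.hamiltonian J) J := by
  apply DifferentiableAt.hasGradientAt
  obtain ⟨e, he, -⟩ := exists_hasFDerivAt_energy (A.differentiable 0 J hJ)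
  have h := he.comp J ((A.hasStrictFDerivAt hJ 0).hasFDerivAt.comp J (hasFDerivAt_prodMk_right 0 J))
  refine (h.differentiableAt).congr_of_eventuallyEq ?_
  filter_upwards [A.isOpen_actions.mem_nhds hJ] with J' hJ'
  exact (A.energy_eq 0 J' hJ').symm

/-- In action-angle variables the Hamiltonian vector field is `(∂E/∂J, 0)`. -/
theorem fderiv_frequency (hJ : J ∈ A.actions) (θ : Space) :
    fderiv ℝ A.toPhase (θ, J) (gradient A.hamiltonian J, 0)
      = ((A.toPhase (θ, J)).2, -gradient Φ (A.toPhase (θ, J)).1) := by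
  obtain ⟨e, he, hes⟩ := exists_hasFDerivAt_energy (A.differentiable θ J hJ)
  have h1 := he.comp _ (A.hasStrictFDerivAt hJ θ).hasFDerivAt
  have h2 : HasFDerivAt (fun z : Space × Space => A.hamiltonian z.2) _ (θ, J) :=
    (A.hasGradientAt_hamiltonian hJ).hasFDerivAt.comp (θ, J) hasFDerivAt_snd
  have h3 : energy Φ ∘ A.toPhase =ᶠ[𝓝 (θ, J)] fun z => A.hamiltonian z.2 := by
    filter_upwards [continuousAt_snd.eventually (A.isOpen_actions.mem_nhds hJ)] with z hz
    exact A.energy_eq z.1 z.2 hz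
  have h4 := (h1.congr_of_eventuallyEq h3.symm).unique h2
  -- Both fields have the same symplectic pairing with every vector, by canonicity; nondegeneracy
  -- identifies them.
  refine sub_eq_zero.1 (eq_zero_of_sympl_eq_zero fun w => ?_)
  obtain ⟨b, rfl⟩ := A.fderiv_surjective hJ θ w
  have h5 := DFunLike.congr_fun h4 b
  simp only [ContinuousLinearMap.comp_apply, hes] at h5
  rw [sympl_sub_left, A.canonical θ J hJ, h5]
  simp [sympl]

end ActionAngle

/-- If independent functions have differentials vanishing on the angle directions, then their
differentials are jointly injective on the action directions. -/
theorem ActionAngle.eq_zero_of_fderiv_action_eq_zero {Φ : Space → ℝ} (A : ActionAngle Φ)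
    {J : Space} (hJ : J ∈ A.actions) {θ : Space} {l : Fin 3 → Phase →L[ℝ] ℝ}
    (hl : LinearIndependent ℝ l)
    (h0 : ∀ i a, l i (fderiv ℝ A.toPhase (θ, J) (a, 0)) = 0) {η : Space}
    (hη : ∀ i, l i (fderiv ℝ A.toPhase (θ, J) (0, η)) = 0) : η = 0 := by
  let M : Space →ₗ[ℝ] (Fin 3 → ℝ) := LinearMap.pi fun i =>
    ((l i).comp ((fderiv ℝ A.toPhase (θ, J)).comp
      (ContinuousLinearMap.inr ℝ Space Space))).toLinearMap
  have hM : ∀ b i, M b i = l i (fderiv ℝ A.toPhase (θ, J) (0, b)) := fun b i => rfl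
  have hsurj : LinearMap.range M = ⊤ := by
    by_contra hne
    -- A nonzero functional killing the range would be a linear relation among the `l i`.
    obtain ⟨c, hc0, hc⟩ := Submodule.exists_le_ker_of_lt_top _ (lt_top_iff_ne_top.2 hne)
    apply hc0
    have hsum : ∑ i, c (Pi.single i 1) • l i = 0 := by
      refine ContinuousLinearMap.ext fun w => ?_
      obtain ⟨⟨a, b⟩, rfl⟩ := A.fderiv_surjective hJ θ w
      have hab : ((a, b) : Space × Space) = (a, 0) + (0, b) := by simp
      have hb : c (M b) = 0 := hc ⟨b, rfl⟩
      rw [LinearMap.pi_apply_eq_sum_univ] at hb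
      rw [hab]
      simp only [map_add, sum_apply, smul_apply, h0,
        smul_zero, Finset.sum_const_zero, zero_add, zero_apply]
      refine Eq.trans ?_ hb
      refine Finset.sum_congr rfl fun i _ => ?_
      simp only [hM, smul_eq_mul, mul_comm]
      congr 2
      ext j
      simp [Pi.single_apply, eq_comm]
    have hz := Fintype.linearIndependent_iff.1 hl _ hsum
    exact LinearMap.pi_ext' fun i => LinearMap.ext_ring (by simpa using hz i)
  have hinj : Function.Injective M :=
    (LinearMap.injective_iff_surjective_of_finrank_eq_finrank (by simp)).2
      (LinearMap.range_eq_top.1 hsurj)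
  exact hinj (by rw [map_zero]; ext i; exact hη i)

/-- A steady-state distribution function is constant on every non-resonant torus in `Ω`. -/
theorem IsSteadyState.eq_on_nonresonant_torus {Φ : Space → ℝ} {Ω : Set Phase} {f : Phase → ℝ}
    (hf : IsSteadyState Φ Ω f) (hΩ : IsOpen Ω) (A : ActionAngle Φ) {J : Space}
    (hJ : J ∈ A.actions) (hT : A.torus J ⊆ Ω) (hres : A.NonresonantAt J) (θ θ' : Space) :
    f (A.toPhase (θ, J)) = f (A.toPhase (θ', J)) := by
  have hmem : ∀ η, A.toPhase (η, J) ∈ Ω := fun η => hT ⟨η, rfl⟩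
  refine eq_of_periodic_of_flow_invariant (g := fun η => f (A.toPhase (η, J))) ?_ ?_ hres ?_ θ θ'
  · exact continuous_iff_continuousAt.2 fun η =>
      ContinuousAt.comp (g := f) (hf.hasStrictFDerivAt hΩ (hmem η)).continuousAt
        (A.continuous_toPhase_left hJ).continuousAt
  · intro η k
    simp only [A.periodic η J hJ k]
  · intro η t
    set w := gradient A.hamiltonian J
    have hd : ∀ s : ℝ, HasDerivAt (fun s : ℝ => f (A.toPhase (η + s • w, J))) 0 s := by
      intro s
      have h1 : HasDerivAt (fun s : ℝ => ((η + s • w, J) : Space × Space)) (w, 0) s := by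
        have h : HasDerivAt (fun s : ℝ => η + s • w) w s := by
          simpa using ((hasDerivAt_id s).smul_const w).const_add η
        exact h.prodMk (hasDerivAt_const s J)
      have h2 := (A.hasStrictFDerivAt hJ (η + s • w)).hasFDerivAt.comp_hasDerivAt s h1
      have h3 := (hf.hasStrictFDerivAt hΩ (hmem (η + s • w))).hasFDerivAt.comp_hasDerivAt s h2
      rw [A.fderiv_frequency hJ, hf.fderiv_apply_eq_zero (hmem _)] at h3
      exact h3
    have := is_const_of_deriv_eq_zero (fun s => (hd s).differentiableAt) (fun s => (hd s).deriv) t 0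
    simpa using this

/-! ### Compactness of the tori. -/

namespace ActionAngle

variable {Φ : Space → ℝ} (A : ActionAngle Φ) {J : Space}

/-- Every torus is the image of a compact period cell. -/
theorem exists_mem_cell (hJ : J ∈ A.actions) (θ : Space) :
    ∃ η ∈ Metric.closedBall (0 : Space) 20, A.toPhase (η, J) = A.toPhase (θ, J) := by
  -- Each angle is reduced to `[0, 2π)`; the bounds 8 and 20 are crude, with `3 * 64 ≤ 20 ^ 2`.
  refine ⟨θ + period fun i => -⌊θ i / (2 * Real.pi)⌋, ?_, A.periodic θ J hJ _⟩
  have hpi := Real.pi_pos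
  rw [mem_closedBall_zero_iff, EuclideanSpace.norm_eq, Real.sqrt_le_left (by norm_num)]
  have h : ∀ i, ‖(θ + period fun i => -⌊θ i / (2 * Real.pi)⌋ : Space) i‖ ^ 2 ≤ 64 := by
    intro i
    have h0 : (θ + period fun i => -⌊θ i / (2 * Real.pi)⌋ : Space) i
        = 2 * Real.pi * Int.fract (θ i / (2 * Real.pi)) := by
      simp only [period, PiLp.add_apply, Int.fract]
      push_cast
      field_simp
      ring
    rw [h0, Real.norm_eq_abs, sq_abs]
    have h1 := Int.fract_nonneg (θ i / (2 * Real.pi))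
    have h2 := (Int.fract_lt_one (θ i / (2 * Real.pi))).le
    have h3 : 2 * Real.pi * Int.fract (θ i / (2 * Real.pi)) ≤ 8 :=
      calc _ ≤ 2 * Real.pi * 1 := by gcongr
        _ ≤ 8 := by linarith [Real.pi_le_four]
    have h4 : 0 ≤ 2 * Real.pi * Int.fract (θ i / (2 * Real.pi)) := by positivity
    nlinarith
  calc _ ≤ ∑ _i : Fin 3, (64 : ℝ) := Finset.sum_le_sum fun i _ => h i
    _ ≤ 20 ^ 2 := by norm_num

theorem torus_eq_image (hJ : J ∈ A.actions) :
    A.torus J = (fun θ => A.toPhase (θ, J)) '' Metric.closedBall (0 : Space) 20 := by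
  apply Subset.antisymm
  · rintro _ ⟨θ, rfl⟩
    exact A.exists_mem_cell hJ θ
  · exact image_subset_range _ _

theorem isCompact_torus (hJ : J ∈ A.actions) : IsCompact (A.torus J) := by
  rw [A.torus_eq_image hJ]
  exact (isCompact_closedBall _ _).image (A.continuous_toPhase_left hJ)

theorem isPreconnected_torus (hJ : J ∈ A.actions) : IsPreconnected (A.torus J) :=
  isPreconnected_range (A.continuous_toPhase_left hJ)

/-- Tube lemma over the compact period cell. -/
theorem eventually_torus_subset (hJ : J ∈ A.actions) {Ω : Set Phase} (hΩ : IsOpen Ω)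
    (hT : A.torus J ⊆ Ω) : ∀ᶠ J' in 𝓝 J, J' ∈ A.actions ∧ A.torus J' ⊆ Ω := by
  have h1 : ∀ᶠ J' in 𝓝 J, ∀ θ ∈ Metric.closedBall (0 : Space) 20, A.toPhase (θ, J') ∈ Ω := by
    refine (isCompact_closedBall (0 : Space) 20).eventually_forall_of_forall_eventually
      fun θ _ => ?_
    have h : ∀ᶠ z in 𝓝 (θ, J), A.toPhase z ∈ Ω :=
      (A.hasStrictFDerivAt hJ θ).continuousAt.eventually (hΩ.mem_nhds (hT ⟨θ, rfl⟩))
    exact (continuous_swap.tendsto (J, θ)).eventually h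
  filter_upwards [h1, A.isOpen_actions.mem_nhds hJ] with J' h hJ'
  refine ⟨hJ', ?_⟩
  rw [A.torus_eq_image hJ']
  rintro _ ⟨θ, hθ, rfl⟩
  exact h θ hθ

end ActionAngle

/-- If almost all tori are non-resonant, steady-state distribution functions are constant on every
torus in `Ω`. -/
theorem IsSteadyState.eq_on_torus {Φ : Space → ℝ} {Ω : Set Phase} {f : Phase → ℝ}
    (hf : IsSteadyState Φ Ω f) (hΩ : IsOpen Ω) (A : ActionAngle Φ)
    (hres : ∀ᵐ J ∂(volume.restrict A.actions), A.NonresonantAt J) {J : Space}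
    (hJ : J ∈ A.actions) (hT : A.torus J ⊆ Ω) (θ θ' : Space) :
    f (A.toPhase (θ, J)) = f (A.toPhase (θ', J)) := by
  rw [ae_restrict_iff' A.isOpen_actions.measurableSet] at hres
  -- A set of full measure is dense, so non-resonant actions accumulate at `J`.
  have hdense : ∃ᶠ J' in 𝓝 J, J' ∈ A.actions → A.NonresonantAt J' :=
    mem_closure_iff_frequently.1 (Measure.dense_of_ae hres J)
  have hfreq : ∃ᶠ J' in 𝓝 J, f (A.toPhase (θ, J')) = f (A.toPhase (θ', J')) := by
    refine (hdense.and_eventually (A.eventually_torus_subset hJ hΩ hT)).mono ?_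
    rintro J' ⟨h1, h2, h3⟩
    exact hf.eq_on_nonresonant_torus hΩ A h2 h3 (h1 h2) θ θ'
  have hcont : ∀ η, ContinuousAt (fun J' => f (A.toPhase (η, J'))) J := fun η =>
    ContinuousAt.comp (g := fun z => f (A.toPhase z)) (f := fun J' => (η, J'))
      (ContinuousAt.comp (g := f) (hf.hasStrictFDerivAt hΩ (hT ⟨η, rfl⟩)).continuousAt
        (A.hasStrictFDerivAt hJ η).continuousAt) (by fun_prop)
  by_contra hne
  exact hfreq (((hcont θ).prodMk (hcont θ')).eventually
    (isClosed_diagonal.isOpen_compl.mem_nhds hne))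

/-- A torus in `Ω` is relatively open in the common level set of the `fᵢ`. -/
theorem eventually_mem_torus_of_eq {Φ : Space → ℝ} {Ω : Set Phase} (hΩ : IsOpen Ω)
    {f : Fin 3 → Phase → ℝ} (hf : ∀ i, IsSteadyState Φ Ω (f i)) (hind : IndependentOn Ω f)
    (A : ActionAngle Φ) (hres : ∀ᵐ J ∂(volume.restrict A.actions), A.NonresonantAt J)
    {J : Space} (hJ : J ∈ A.actions) (hT : A.torus J ⊆ Ω) (θ : Space) :
    ∀ᶠ q in 𝓝 (A.toPhase (θ, J)), (∀ i, f i q = f i (A.toPhase (θ, J))) → q ∈ A.torus J := by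
  set D := fderiv ℝ A.toPhase (θ, J)
  set l := fun i => fderiv ℝ (f i) (A.toPhase (θ, J))
  have hp : A.toPhase (θ, J) ∈ Ω := hT ⟨θ, rfl⟩
  have hstrict : ∀ i, HasStrictFDerivAt (fun z => f i (A.toPhase z)) ((l i).comp D) (θ, J) :=
    fun i => ((hf i).hasStrictFDerivAt hΩ hp).comp (θ, J) (A.hasStrictFDerivAt hJ θ)
  have h0 : ∀ i a, l i (D (a, 0)) = 0 := by
    intro i a
    have h1 := HasFDerivAt.comp (f := fun η : Space => (η, J)) θ (hstrict i).hasFDerivAt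
      (hasFDerivAt_prodMk_left θ J)
    have h2 : HasFDerivAt (fun η => f i (A.toPhase (η, J))) (0 : Space →L[ℝ] ℝ) θ :=
      (hasFDerivAt_const (f i (A.toPhase (θ, J))) θ).congr_of_eventuallyEq
        (Eventually.of_forall fun η => (hf i).eq_on_torus hΩ A hres hJ hT η θ)
    exact DFunLike.congr_fun (h1.unique h2) a
  let M : Space →L[ℝ] (Fin 3 → ℝ) :=
    ContinuousLinearMap.pi fun i => ((l i).comp D).comp (ContinuousLinearMap.inr ℝ Space Space)
  have hM : HasStrictFDerivAt (fun J' i => f i (A.toPhase (θ, J'))) M J :=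
    hasStrictFDerivAt_pi.2 fun i => (hstrict i).comp (f := fun J' => (θ, J')) J
      ((hasStrictFDerivAt_const θ J).prodMk (hasStrictFDerivAt_id J))
  have hinj : LinearMap.ker M.toLinearMap = ⊥ := LinearMap.ker_eq_bot'.2 fun η hη =>
    A.eq_zero_of_fderiv_action_eq_zero hJ (hind _ hp) h0 fun i => congrFun hη i
  have hsurj : LinearMap.range M.toLinearMap = ⊤ := LinearMap.range_eq_top.2
    ((LinearMap.injective_iff_surjective_of_finrank_eq_finrank (by simp)).1
      (LinearMap.ker_eq_bot.1 hinj))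
  have hM' : HasStrictFDerivAt (fun J' i => f i (A.toPhase (θ, J')))
      (ContinuousLinearEquiv.ofBijective M hinj hsurj : Space →L[ℝ] (Fin 3 → ℝ)) J := by
    rwa [ContinuousLinearEquiv.coe_ofBijective]
  have hloc : ∀ᶠ J' in 𝓝 J, (∀ i, f i (A.toPhase (θ, J')) = f i (A.toPhase (θ, J))) → J' = J := by
    filter_upwards [hM'.eventually_left_inverse] with J' h h'
    rw [← h, funext h']
    exact hM'.eventually_left_inverse.self_of_nhds
  rw [← A.map_nhds_toPhase hJ θ, eventually_map]
  have hev := (continuousAt_snd (p := (θ, J))).eventually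
    (hloc.and (A.eventually_torus_subset hJ hΩ hT))
  filter_upwards [hev] with z ⟨hz, hz1, hz2⟩ hq
  -- The nearby point slides along its own torus to the angle `θ`, where the `f i` separate actions
  -- near `J`.
  have hzJ : z.2 = J := hz fun i => by
    rw [(hf i).eq_on_torus hΩ A hres hz1 hz2 θ z.1]
    exact hq i
  exact ⟨z.1, by rw [← hzJ]⟩

/-- The torus is connected, closed and relatively open in the level set, hence a whole component. -/
theorem connectedComponentIn_commonLevel {Φ : Space → ℝ} {Ω : Set Phase} (hΩ : IsOpen Ω)
    {f : Fin 3 → Phase → ℝ} (hf : ∀ i, IsSteadyState Φ Ω (f i)) (hind : IndependentOn Ω f)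
    (A : ActionAngle Φ) (hres : ∀ᵐ J ∂(volume.restrict A.actions), A.NonresonantAt J)
    {J : Space} (hJ : J ∈ A.actions) (hT : A.torus J ⊆ Ω) {p : Phase} (hp : p ∈ A.torus J) :
    connectedComponentIn (commonLevel Ω f p) p = A.torus J := by
  have hsub : A.torus J ⊆ commonLevel Ω f p := by
    obtain ⟨θ, rfl⟩ := hp
    rintro _ ⟨η, rfl⟩
    exact ⟨hT ⟨η, rfl⟩, fun i => (hf i).eq_on_torus hΩ A hres hJ hT η θ⟩
  have hopen : ∀ q ∈ A.torus J, ∀ᶠ q' in 𝓝 q, q' ∈ commonLevel Ω f p → q' ∈ A.torus J := by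
    intro q hq
    obtain ⟨θ, rfl⟩ := id hq
    filter_upwards [eventually_mem_torus_of_eq hΩ hf hind A hres hJ hT θ] with q' h hq'
    exact h fun i => (hq'.2 i).trans ((hsub hq).2 i).symm
  apply Subset.antisymm
  · intro q hq
    by_contra hqT
    obtain ⟨r, hrC, hrU, hrT⟩ := isPreconnected_connectedComponentIn
      (interior {r | r ∈ commonLevel Ω f p → r ∈ A.torus J}) (A.torus J)ᶜ isOpen_interior
      (A.isCompact_torus hJ).isClosed.isOpen_compl
      (fun r _ => (em (r ∈ A.torus J)).imp
        (fun hr => mem_interior_iff_mem_nhds.2 (hopen r hr)) id)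
      ⟨p, mem_connectedComponentIn (hsub hp), mem_interior_iff_mem_nhds.2 (hopen p hp)⟩
      ⟨q, hq, hqT⟩
    exact hrT (interior_subset hrU (connectedComponentIn_subset _ _ hrC))
  · exact (A.isPreconnected_torus hJ).subset_connectedComponentIn hp hsub

/-- The energy in a potential shared by the `fᵢ` is stationary along a torus at points near which
the `fᵢ` are constant on the torus. -/
theorem ActionAngle.hasFDerivAt_energy_eq_zero {Φ Ψ : Space → ℝ} {Ω : Set Phase}
    (hΩ : IsOpen Ω) {f : Fin 3 → Phase → ℝ} (hf : ∀ i, IsSteadyState Ψ Ω (f i))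
    (hind : IndependentOn Ω f) (A : ActionAngle Φ) {J : Space} (hJ : J ∈ A.actions) {θ : Space}
    (hp : A.toPhase (θ, J) ∈ Ω) (hΨ : DifferentiableAt ℝ Ψ (A.toPhase (θ, J)).1)
    (hconst : ∀ᶠ η in 𝓝 θ, ∀ i, f i (A.toPhase (η, J)) = f i (A.toPhase (θ, J))) :
    HasFDerivAt (fun η => energy Ψ (A.toPhase (η, J))) (0 : Space →L[ℝ] ℝ) θ := by
  have hD := HasFDerivAt.comp (f := fun η : Space => (η, J)) θ
    (A.hasStrictFDerivAt hJ θ).hasFDerivAt (hasFDerivAt_prodMk_left θ J)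
  have h0 : ∀ i a, fderiv ℝ (f i) (A.toPhase (θ, J)) (fderiv ℝ A.toPhase (θ, J) (a, 0)) = 0 := by
    intro i a
    have h1 := ((hf i).hasStrictFDerivAt hΩ hp).hasFDerivAt.comp θ hD
    have h2 : HasFDerivAt (fun η => f i (A.toPhase (η, J))) (0 : Space →L[ℝ] ℝ) θ :=
      (hasFDerivAt_const (f i (A.toPhase (θ, J))) θ).congr_of_eventuallyEq
        (hconst.mono fun η h => h i)
    exact DFunLike.congr_fun (h1.unique h2) a
  obtain ⟨⟨ξ, ζ⟩, hX⟩ := A.fderiv_surjective hJ θ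
    ((A.toPhase (θ, J)).2, -gradient Ψ (A.toPhase (θ, J)).1)
  -- The Hamiltonian field of `Ψ` is killed by every `df i`, so it has no action component.
  have hζ : ζ = 0 := by
    refine A.eq_zero_of_fderiv_action_eq_zero hJ (hind _ hp) h0 fun i => ?_
    have h := (hf i).fderiv_apply_eq_zero hp
    rwa [← hX, show ((ξ, ζ) : Space × Space) = (ξ, 0) + (0, ζ) by simp, map_add, map_add, h0,
      zero_add] at h
  obtain ⟨e, he, hes⟩ := exists_hasFDerivAt_energy hΨ
  have h := he.comp θ hD
  refine h.congr_fderiv (ContinuousLinearMap.ext fun a => ?_)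
  change e (fderiv ℝ A.toPhase (θ, J) (a, 0)) = 0
  -- Two pure angle vectors pair to zero: the torus is Lagrangian.
  rw [hes, ← hX, hζ, A.canonical θ J hJ]
  simp [sympl]

/-- The energy in a potential shared by the `fᵢ` is constant on a torus patch. -/
theorem IsTorusPatch.energy_eq {Φ Ψ : Space → ℝ} {S : IntegrableSystem Φ} {Ω : Set Phase}
    (hΩ : IsOpen Ω) {f : Fin 3 → Phase → ℝ} (hf : ∀ i, IsSteadyState Ψ Ω (f i))
    (hind : IndependentOn Ω f) (hΨ : ∀ p ∈ Ω, DifferentiableAt ℝ Ψ p.1) {Γ : Set Phase}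
    (hΓ : IsTorusPatch S Ω f Γ) {p q : Phase} (hp : p ∈ Γ) (hq : q ∈ Γ) :
    energy Ψ p = energy Ψ q := by
  obtain ⟨hconn, hΓΩ, ⟨T, ⟨A, -, J, hJ, rfl⟩, U, hU, hΓU⟩, c, hc⟩ := hΓ
  have hcont := A.continuous_toPhase_left hJ
  have hmem : ∀ η ∈ (fun η => A.toPhase (η, J)) ⁻¹' U, A.toPhase (η, J) ∈ Γ := fun η hη => by
    rw [hΓU]
    exact ⟨⟨η, rfl⟩, hη⟩
  have hd : ∀ η ∈ (fun η => A.toPhase (η, J)) ⁻¹' U,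
      HasFDerivAt (fun η => energy Ψ (A.toPhase (η, J))) (0 : Space →L[ℝ] ℝ) η := by
    intro η hη
    refine A.hasFDerivAt_energy_eq_zero hΩ hf hind hJ (hΓΩ (hmem η hη))
      (hΨ _ (hΓΩ (hmem η hη))) ?_
    filter_upwards [(hU.preimage hcont).mem_nhds hη] with η' hη' i
    rw [hc _ (hmem η' hη') i, hc _ (hmem η hη) i]
  have hloc : ∀ r ∈ Γ, ∀ᶠ r' in 𝓝[Γ] r, energy Ψ r' = energy Ψ r := by
    intro r hr
    obtain ⟨⟨θ, rfl⟩, hrU⟩ := hΓU ▸ hr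
    obtain ⟨ε, hε, hball⟩ := Metric.isOpen_iff.1 (hU.preimage hcont) θ hrU
    have hnear : ∀ᶠ η in 𝓝 θ, energy Ψ (A.toPhase (η, J)) = energy Ψ (A.toPhase (θ, J)) := by
      filter_upwards [Metric.ball_mem_nhds θ hε] with η hη
      exact Metric.isOpen_ball.is_const_of_fderiv_eq_zero (𝕜 := ℝ)
        (f := fun η => energy Ψ (A.toPhase (η, J))) (convex_ball θ ε).isPreconnected
        (fun z hz => (hd z (hball hz)).differentiableAt.differentiableWithinAt)
        (fun z hz => (hd z (hball hz)).fderiv) hη (Metric.mem_ball_self hε)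
    rw [eventually_nhdsWithin_iff]
    filter_upwards [A.eventually_mem_torus hJ θ
      (P := fun r' => energy Ψ r' = energy Ψ (A.toPhase (θ, J))) hnear] with r' h hr'
    exact h (hΓU ▸ hr').1
  have : PreconnectedSpace Γ := isPreconnected_iff_preconnectedSpace.1 hconn.isPreconnected
  have hlc : IsLocallyConstant fun r : Γ => energy Ψ r :=
    (IsLocallyConstant.iff_eventually_eq _).2 fun r =>
      (eventually_nhds_subtype_iff Γ r fun r' => energy Ψ r' = energy Ψ r).2 (hloc r r.2)
  exact hlc.apply_eq_of_preconnectedSpace ⟨p, hp⟩ ⟨q, hq⟩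

end DynTomography

theorem theorem1 (Φ : DynTomography.Space → ℝ) (S : DynTomography.IntegrableSystem Φ)
    (Ω : Set DynTomography.Phase) (hΩ : IsOpen Ω) (hΩS : Ω ⊆ S.region)
    (f : Fin 3 → DynTomography.Phase → ℝ)
    (hf : ∀ i, DynTomography.IsSteadyState Φ Ω (f i))
    (hind : DynTomography.IndependentOn Ω f) :
    -- the intersections of the level surfaces are the invariant tori
    (S.Nonresonant → ∀ T, S.IsTorus T → T ⊆ Ω → ∀ p ∈ T,
      connectedComponentIn (DynTomography.commonLevel Ω f p) p = T) ∧
    -- a chain of torus patches determines the potential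
    (∀ (ι : Type) (Γ : ι → Set DynTomography.Phase),
      (∀ k, DynTomography.IsTorusPatch S Ω f (Γ k)) → DynTomography.ConnectedInX Γ →
      ∀ Ψ : DynTomography.Space → ℝ, (∀ p ∈ Ω, DifferentiableAt ℝ Ψ p.1) →
        (∀ i, DynTomography.IsSteadyState Ψ Ω (f i)) →
        (∃ e : ι → ℝ,
          (∀ k, ∀ p ∈ Γ k, Ψ p.1 = e k - (1 / 2) * ‖p.2‖ ^ 2) ∧
          (∀ k l, ∀ p ∈ Γ k, ∀ q ∈ Γ l, p.1 = q.1 →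
            e l = e k + (1 / 2) * (‖q.2‖ ^ 2 - ‖p.2‖ ^ 2))) ∧
        (∃ c : ℝ, ∀ x ∈ ⋃ k, Prod.fst '' Γ k, Ψ x = Φ x + c)) := by
  constructor
  · rintro hres T ⟨A, hA, J, hJ, rfl⟩ hT p hp
    exact DynTomography.connectedComponentIn_commonLevel hΩ hf hind A (hres A hA) hJ hT hp
  · intro ι Γ hΓ hchain Ψ hΨ hfΨ
    have hΦ : ∀ p ∈ Ω, DifferentiableAt ℝ Φ p.1 := by
      intro p hp
      obtain ⟨A, -, J, hJ, θ, rfl⟩ := S.exists_torus p (hΩS hp)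
      exact A.differentiable θ J hJ
    have hpot : ∀ X : DynTomography.Space → ℝ, (∀ p ∈ Ω, DifferentiableAt ℝ X p.1) →
        (∀ i, DynTomography.IsSteadyState X Ω (f i)) →
        ∃ e : ι → ℝ, ∀ k, ∀ p ∈ Γ k, X p.1 = e k - (1 / 2) * ‖p.2‖ ^ 2 := by
      intro X hX hfX
      choose r hr using fun k => (hΓ k).1.nonempty
      refine ⟨fun k => DynTomography.energy X (r k), fun k p hp => ?_⟩
      have h := (hΓ k).energy_eq hΩ hfX hind hX hp (hr k)
      simp only [DynTomography.energy] at h ⊢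
      linarith
    obtain ⟨e, he⟩ := hpot Ψ hΨ hfΨ
    obtain ⟨h, hh⟩ := hpot Φ hΦ hf
    refine ⟨⟨e, he, fun k l p hp q hq hpq => ?_⟩, ?_⟩
    · have h1 := he k p hp
      have h2 := he l q hq
      rw [hpq] at h1
      linarith
    -- At a common position both patches give the same `Ψ - Φ`, so `e - h` is constant along the
    -- chain.
    · have hstep : ∀ k l, Relation.ReflTransGen
          (fun a b => ((Prod.fst '' Γ a) ∩ (Prod.fst '' Γ b)).Nonempty) k l →
          e l - h l = e k - h k := by
        intro k l hkl
        induction hkl with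
        | refl => rfl
        | @tail a b _ hab ih =>
          obtain ⟨x, ⟨p, hp, rfl⟩, q, hq, hqp⟩ := hab
          have h1 := he a p hp
          have h2 := he b q hq
          have h3 := hh a p hp
          have h4 := hh b q hq
          rw [hqp] at h2 h4
          linarith
      rcases isEmpty_or_nonempty ι with hι | ⟨⟨k₀⟩⟩
      · exact ⟨0, by simp⟩
      · refine ⟨e k₀ - h k₀, fun x hx => ?_⟩
        obtain ⟨k, p, hp, rfl⟩ := mem_iUnion.1 hx
        have h1 := he k p hp
        have h2 := hh k p hp
        have h3 := hstep k₀ k (hchain k₀ k)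
        linarith
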